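/- Let $d\ge 1$, let $M_d$ be the algebra of complex $d\times d$ matrices and $M_d^+$ its cone of positive semidefinite matrices. A \emph{convex $M_d$-corner} is a non-empty closed convex set $\mathcal A\subseteq M_d^+$ such that $B\in\mathcal A$ and $0\le A\le B$ imply $A\in\mathcal A$. It is called \emph{standard} if it is bounded and has non-empty interior relative to $M_d^+$. The \emph{anti-blocker} of $\mathcal A$ is $\mathcal A^\sharp=\{B\in M_d^+ : \operatorname{Tr}(BA)\le 1 \text{ for all } A\in\mathcal A\}$. For a convex $M_d$-corner $\mathcal A$ put \begin{itemize} \item $\gamma(\mathcal A)=\max\{\operatorname{Tr}A : A\in\mathcal A\}$ if $\mathcal A$ is bounded, and $\gamma(\mathcal A)=\infty$ otherwise; \item $N(\mathcal A)=\max\{\beta : \beta I\in\mathcal A\}$ if $\mathcal A\neq M_d^+$, and $N(M_d^+)=\infty$; \item $M(\mathcal A)=\inf\{\sum_{i=1}^k\lambda_i : k\in\mathbb N,\ \lambda_i>0,\ A_i\in\mathcal A,\ \sum_{i=1}^k\lambda_iA_i\ge I\}$ if $\mathcal A$ has non-empty interior relative to $M_d^+$, and $M(\mathcal A)=\infty$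 otherwise. \end{itemize} Let $\mathcal R_d=\{\rho\in M_d^+ : \operatorname{Tr}\rho=1\}$ be the set of states. For $\rho, A\in M_d^+$ with $A=\sum_{i=1}^d\lambda_iu_iu_i^*$, where $(u_i)$ is an orthonormal basis of $\mathbb C^d$, let $\operatorname{Tr}(\rho\log A)=\sum_{i=1}^d\langle\rho u_i,u_i\rangle\log\lambda_i$ (with $0\log 0=0$) if $\ker A\subseteq\ker\rho$, and $\operatorname{Tr}(\rho\log A)=-\infty$ otherwise. The \emph{entropy} of $\rho\in\mathcal R_d$ over a bounded convex $M_d$-corner $\mathcal A$ is $H_{\mathcal A}(\rho)=\min_{A\in\mathcal A}-\operatorname{Tr}(\rho\log A)$. \textbf{Theorem.} Let $\mathcal A$ be a standard convex $M_d$-corner. Then the minimum defining $H_{\mathcal A}(\rho)$ is attained for every $\rho\in\mathcal R_d$, the maxima defining $N(\mathcal A)$ and $\gamma(\mathcal A^\sharp)$ are attained, $0<N(\mathcal A)<\infty$, the function $H_{\mathcal A}$ attains a maximum on $\mathcal R_d$, and $$\max_{\rho\in\mathcal R_d}H_{\mathcal A}(\rho)=-\log N(\mathcal A)=\log M(\mathcal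 A)=\log\gamma(\mathcal A^\sharp).$$ -/

import Mathlib

namespace ConvexCorner

open scoped Matrix ENNReal ComplexOrder

/-- The Hilbert-Schmidt norm of a complex `d × d` matrix. -/
noncomputable def hsNorm {d : ℕ} (X : Matrix (Fin d) (Fin d) ℂ) : ℝ :=
  Real.sqrt (∑ i, ∑ j, ‖X i j‖ ^ 2)

/-- Boundedness of a set of matrices. -/
def IsBddSet {d : ℕ} (𝒜 : Set (Matrix (Fin d) (Fin d) ℂ)) : Prop :=
  ∃ R : ℝ, ∀ X ∈ 𝒜, hsNorm X ≤ R

/-- `𝒜` has non-empty interior relative to the cone of positive semidefinite matrices. -/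
def HasRelInterior {d : ℕ} (𝒜 : Set (Matrix (Fin d) (Fin d) ℂ)) : Prop :=
  ∃ A ∈ 𝒜, ∃ δ : ℝ, 0 < δ ∧
    ∀ X : Matrix (Fin d) (Fin d) ℂ, X.PosSemidef → hsNorm (X - A) < δ → X ∈ 𝒜

/-- Convex `M_d`-corners: non-empty closed convex hereditary sets of positive semidefinite
matrices. -/
structure IsConvexCorner {d : ℕ} (𝒜 : Set (Matrix (Fin d) (Fin d) ℂ)) : Prop where
  nonempty : 𝒜.Nonempty
  posSemidef : ∀ A ∈ 𝒜, A.PosSemidef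
  isClosed : IsClosed 𝒜
  convex : Convex ℝ 𝒜
  hereditary : ∀ A B : Matrix (Fin d) (Fin d) ℂ,
    B ∈ 𝒜 → A.PosSemidef → (B - A).PosSemidef → A ∈ 𝒜

/-- Standard convex corners: bounded, with non-empty relative interior. -/
structure IsStandard {d : ℕ} (𝒜 : Set (Matrix (Fin d) (Fin d) ℂ)) : Prop
    extends IsConvexCorner 𝒜 where
  bounded : IsBddSet 𝒜
  relInterior : HasRelInterior 𝒜

/-- The anti-blocker `𝒜^♯`. -/
def antiBlocker {d : ℕ} (𝒜 : Set (Matrix (Fin d) (Fin d) ℂ)) :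
    Set (Matrix (Fin d) (Fin d) ℂ) :=
  {B | B.PosSemidef ∧ ∀ A ∈ 𝒜, (B * A).trace.re ≤ 1}

/-- The values `Tr A`, `A ∈ 𝒜`. -/
noncomputable def traceValues {d : ℕ} (𝒜 : Set (Matrix (Fin d) (Fin d) ℂ)) : Set ℝ≥0∞ :=
  {x | ∃ A ∈ 𝒜, x = ENNReal.ofReal A.trace.re}

open Classical in
/-- `γ(𝒜) = max {Tr A : A ∈ 𝒜}` if `𝒜` is bounded, and `∞` otherwise. -/
noncomputable def gammaParam {d : ℕ} (𝒜 : Set (Matrix (Fin d) (Fin d) ℂ)) : ℝ≥0∞ :=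
  if IsBddSet 𝒜 then sSup (traceValues 𝒜) else ⊤

/-- The values `β ≥ 0` with `β I ∈ 𝒜`. -/
noncomputable def scalarValues {d : ℕ} (𝒜 : Set (Matrix (Fin d) (Fin d) ℂ)) : Set ℝ≥0∞ :=
  {x | ∃ β : ℝ, 0 ≤ β ∧ β • (1 : Matrix (Fin d) (Fin d) ℂ) ∈ 𝒜 ∧ x = ENNReal.ofReal β}

open Classical in
/-- `N(𝒜) = max {β : β I ∈ 𝒜}` if `𝒜` is not the whole cone, and `∞` otherwise. -/
noncomputable def NParam {d : ℕ} (𝒜 : Set (Matrix (Fin d) (Fin d) ℂ)) : ℝ≥0∞ :=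
  if 𝒜 ≠ {X | X.PosSemidef} then sSup (scalarValues 𝒜) else ⊤

open Classical in
/-- `M(𝒜)`: the infimum of `∑ λ_i` over all finite families `λ_i > 0`, `A_i ∈ 𝒜` with
`∑ λ_i A_i ≥ I`, if `𝒜` has non-empty relative interior, and `∞` otherwise. -/
noncomputable def MParam {d : ℕ} (𝒜 : Set (Matrix (Fin d) (Fin d) ℂ)) : ℝ≥0∞ :=
  if HasRelInterior 𝒜 then
    sInf {x | ∃ (k : ℕ) (c : Fin k → ℝ) (A : Fin k → Matrix (Fin d) (Fin d) ℂ),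
      (∀ i, 0 < c i) ∧ (∀ i, A i ∈ 𝒜) ∧ ((∑ i, c i • A i) - 1).PosSemidef ∧
      x = ENNReal.ofReal (∑ i, c i)}
  else ⊤

/-- The states `ρ ≥ 0`, `Tr ρ = 1`. -/
def states (d : ℕ) : Set (Matrix (Fin d) (Fin d) ℂ) :=
  {ρ | ρ.PosSemidef ∧ ρ.trace = 1}

open Classical in
/-- The extended real number `Tr (ρ log A)` for positive semidefinite `ρ` and `A`: it is `-∞`
unless `ker A ⊆ ker ρ`. As `Real.log 0 = 0` and `ρ` vanishes on `ker A` in the first case, the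
convention `0 log 0 = 0` is in force; see `traceLog_eq`. -/
noncomputable def traceLog {d : ℕ} (ρ A : Matrix (Fin d) (Fin d) ℂ) : EReal :=
  if ∀ v : Fin d → ℂ, A *ᵥ v = 0 → ρ *ᵥ v = 0 then
    (((ρ * cfc Real.log A).trace.re : ℝ) : EReal)
  else ⊥

/-- The set of values `-Tr (ρ log A)`, `A ∈ 𝒜`. -/
noncomputable def entropyValues {d : ℕ} (𝒜 : Set (Matrix (Fin d) (Fin d) ℂ))
    (ρ : Matrix (Fin d) (Fin d) ℂ) : Set EReal :=
  {x | ∃ A ∈ 𝒜, x = -traceLog ρ A}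

/-- The entropy `H_𝒜(ρ)` of `ρ` over `𝒜`. -/
noncomputable def entropy {d : ℕ} (𝒜 : Set (Matrix (Fin d) (Fin d) ℂ))
    (ρ : Matrix (Fin d) (Fin d) ℂ) : EReal :=
  sInf (entropyValues 𝒜 ρ)

/-- The functional calculus acts on eigenvectors in the expected way. -/
theorem cfc_mulVec_eigen {d : ℕ} {A : Matrix (Fin d) (Fin d) ℂ} (hA : A.IsHermitian)
    (f : ℝ → ℝ) {v : Fin d → ℂ} {t : ℝ} (hv : v ≠ 0) (h : A *ᵥ v = (t : ℂ) • v) :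
    cfc f A *ᵥ v = (f t : ℂ) • v := by
  have hfin : (spectrum ℝ A).Finite := Matrix.finite_real_spectrum
  let p : Polynomial ℝ := Lagrange.interpolate hfin.toFinset id f
  have hp : ∀ x ∈ spectrum ℝ A, p.eval x = f x := fun x hx => by
    have := Lagrange.eval_interpolate_at_node (s := hfin.toFinset) (v := id) f
      Function.injective_id.injOn (hfin.mem_toFinset.2 hx)
    simpa [p] using this
  have ht : t ∈ spectrum ℝ A := by
    rw [← spectrum.algebraMap_mem_iff ℂ, ← Matrix.spectrum_toLin']
    apply Module.End.HasEigenvalue.mem_spectrum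
    exact Module.End.hasEigenvalue_of_hasEigenvector (x := v)
      ⟨Module.End.mem_eigenspace_iff.2 (by simpa using h), hv⟩
  have hcfc : cfc f A = Polynomial.aeval A p := by
    rw [← cfc_polynomial p A hA]
    exact cfc_congr fun x hx => (hp x hx).symm
  rw [hcfc, ← hp t ht]
  clear hcfc hp
  generalize p = q
  induction q using Polynomial.induction_on' with
  | add p q hp hq => simp [Matrix.add_mulVec, hp, hq, add_smul]
  | monomial n a =>
    have hpow : (A ^ n) *ᵥ v = ((t : ℂ) ^ n) • v := by
      induction n with
      | zero => simp
      | succ n ih =>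
        rw [pow_succ, ← Matrix.mulVec_mulVec, h, Matrix.mulVec_smul, ih, smul_smul, pow_succ,
          mul_comm]
    have : Polynomial.aeval A (Polynomial.monomial n a) = (a : ℂ) • A ^ n := by
      rw [Polynomial.aeval_monomial, Algebra.algebraMap_eq_smul_one, smul_mul_assoc, one_mul]
      ext i j; simp
    rw [this, Matrix.smul_mulVec, hpow, smul_smul]
    simp

/-- If `A = ∑ λ_i u_i u_i^*` with an orthonormal basis `u`, then `traceLog ρ A` is
`∑ ⟨ρ u_i, u_i⟩ log λ_i` as soon as `ker A ⊆ ker ρ`. -/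
theorem traceLog_eq {d : ℕ} (ρ A : Matrix (Fin d) (Fin d) ℂ) (hA : A.IsHermitian)
    (u : OrthonormalBasis (Fin d) ℂ (EuclideanSpace ℂ (Fin d))) (t : Fin d → ℝ)
    (hu : ∀ i, A *ᵥ (u i).ofLp = (t i : ℂ) • (u i).ofLp)
    (hker : ∀ v : Fin d → ℂ, A *ᵥ v = 0 → ρ *ᵥ v = 0) :
    traceLog ρ A =
      ((∑ i, (inner ℂ (u i) (WithLp.toLp 2 (ρ *ᵥ (u i).ofLp))).re * Real.log (t i) : ℝ) :
        EReal) := by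
  rw [traceLog, if_pos hker]
  congr 1
  have h1 : (ρ * cfc Real.log A).trace =
      LinearMap.trace ℂ _ (Matrix.toEuclideanLin (ρ * cfc Real.log A)) := by
    rw [Matrix.toEuclideanLin_eq_toLin_orthonormal, Matrix.trace_toLin_eq]
  rw [h1, LinearMap.trace_eq_sum_inner _ u, Complex.re_sum]
  refine Finset.sum_congr rfl fun i _ => ?_
  have hne : (u i).ofLp ≠ 0 := fun h => u.orthonormal.ne_zero i (by ext j; simp [h])
  have h2 : Matrix.toEuclideanLin (ρ * cfc Real.log A) (u i) =
      (Real.log (t i) : ℂ) • WithLp.toLp 2 (ρ *ᵥ (u i).ofLp) := by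
    rw [Matrix.toLpLin_apply, ← Matrix.mulVec_mulVec,
      cfc_mulVec_eigen hA Real.log hne (hu i), Matrix.mulVec_smul]
    rfl
  rw [h2, inner_smul_right, Complex.re_ofReal_mul, mul_comm]

end ConvexCorner

namespace ConvexCorner

open scoped Matrix ENNReal ComplexOrder Topology
open Filter

variable {d : ℕ}

/-! Everything reduces to the largest `N` with `N • 1 ∈ 𝒜`. Testing with `N • 1` gives entropy at
most `-log N` for every state. For the reverse, Hahn-Banach separates `𝒜` from the open convex set
`formGt d N`; the separating functional is, up to sign and scale, a state `ρ` with `Tr (ρ A) ≤ N` on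
`𝒜` (`exists_state_trace_mul_le`). Jensen's inequality (`traceLog_le_log`) then gives this `ρ`
entropy at least `-log N`. The same `ρ` makes `N⁻¹ • ρ` an element of the anti-blocker of maximal
trace, and normalising a cover of the identity to a convex combination gives `M = N⁻¹`. The entropy
minimum exists because `𝒜` is compact and `-Tr (ρ log A)` is lower semicontinuous, being a supremum
of continuous functions (`neg_traceLog_eq_iSup`). -/

/-! ### Weights of a state in an eigenbasis -/

/-- The diagonal entry `⟨ρ u_i, u_i⟩` of `ρ` in an orthonormal basis. -/
noncomputable def weight (ρ : Matrix (Fin d) (Fin d) ℂ)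
    (u : OrthonormalBasis (Fin d) ℂ (EuclideanSpace ℂ (Fin d))) (i : Fin d) : ℝ :=
  (inner ℂ (u i) (WithLp.toLp 2 (ρ *ᵥ (u i).ofLp))).re

theorem trace_mul_re_eq_sum_weight (ρ B : Matrix (Fin d) (Fin d) ℂ)
    (u : OrthonormalBasis (Fin d) ℂ (EuclideanSpace ℂ (Fin d))) (t : Fin d → ℝ)
    (hu : ∀ i, B *ᵥ (u i).ofLp = (t i : ℂ) • (u i).ofLp) :
    (ρ * B).trace.re = ∑ i, weight ρ u i * t i := by
  have h1 : (ρ * B).trace = LinearMap.trace ℂ _ (Matrix.toEuclideanLin (ρ * B)) := by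
    rw [Matrix.toEuclideanLin_eq_toLin_orthonormal, Matrix.trace_toLin_eq]
  rw [h1, LinearMap.trace_eq_sum_inner _ u, Complex.re_sum]
  refine Finset.sum_congr rfl fun i _ => ?_
  have h2 : Matrix.toEuclideanLin (ρ * B) (u i) =
      (t i : ℂ) • WithLp.toLp 2 (ρ *ᵥ (u i).ofLp) := by
    rw [Matrix.toLpLin_apply, ← Matrix.mulVec_mulVec, hu i, Matrix.mulVec_smul]
    rfl
  rw [h2, inner_smul_right, Complex.re_ofReal_mul, mul_comm]
  rfl

theorem inner_mulVec_eq_dotProduct (ρ : Matrix (Fin d) (Fin d) ℂ) (v : EuclideanSpace ℂ (Fin d)) :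
    inner ℂ v (WithLp.toLp 2 (ρ *ᵥ v.ofLp)) = star v.ofLp ⬝ᵥ (ρ *ᵥ v.ofLp) := by
  rw [EuclideanSpace.inner_eq_star_dotProduct, dotProduct_comm]

theorem weight_nonneg {ρ : Matrix (Fin d) (Fin d) ℂ} (hρ : ρ.PosSemidef)
    (u : OrthonormalBasis (Fin d) ℂ (EuclideanSpace ℂ (Fin d))) (i : Fin d) :
    0 ≤ weight ρ u i := by
  rw [weight, inner_mulVec_eq_dotProduct]
  exact hρ.re_dotProduct_nonneg _

theorem weight_eq_zero_iff {ρ : Matrix (Fin d) (Fin d) ℂ} (hρ : ρ.PosSemidef)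
    (u : OrthonormalBasis (Fin d) ℂ (EuclideanSpace ℂ (Fin d))) (i : Fin d) :
    weight ρ u i = 0 ↔ ρ *ᵥ (u i).ofLp = 0 := by
  rw [weight, inner_mulVec_eq_dotProduct, ← hρ.dotProduct_mulVec_zero_iff]
  have h := Complex.nonneg_iff.1 (hρ.dotProduct_mulVec_nonneg (u i).ofLp)
  rw [Complex.ext_iff]
  simp [← h.2]

theorem sum_weight (ρ : Matrix (Fin d) (Fin d) ℂ)
    (u : OrthonormalBasis (Fin d) ℂ (EuclideanSpace ℂ (Fin d))) :
    ∑ i, weight ρ u i = ρ.trace.re := by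
  simpa using (trace_mul_re_eq_sum_weight ρ 1 u (fun _ => 1) (by simp)).symm

/-- `ker A ⊆ ker ρ`, tested on an eigenbasis of `A`. -/
theorem ker_le_iff_weight {ρ A : Matrix (Fin d) (Fin d) ℂ} (hρ : ρ.PosSemidef)
    (u : OrthonormalBasis (Fin d) ℂ (EuclideanSpace ℂ (Fin d))) (t : Fin d → ℝ)
    (hu : ∀ i, A *ᵥ (u i).ofLp = (t i : ℂ) • (u i).ofLp) :
    (∀ v : Fin d → ℂ, A *ᵥ v = 0 → ρ *ᵥ v = 0) ↔ ∀ i, t i = 0 → weight ρ u i = 0 := by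
  constructor
  · intro h i hi
    exact (weight_eq_zero_iff hρ u i).2 (h _ (by rw [hu i, hi]; simp))
  · intro h v hv
    have hsum : ∀ B : Matrix (Fin d) (Fin d) ℂ, WithLp.toLp 2 (B *ᵥ v) =
        ∑ i, u.repr (WithLp.toLp 2 v) i • WithLp.toLp 2 (B *ᵥ (u i).ofLp) := by
      intro B
      have := congrArg (Matrix.toEuclideanLin B) (u.sum_repr (WithLp.toLp 2 v))
      rw [map_sum] at this
      simp only [map_smul, Matrix.toLpLin_apply] at this
      exact this.symm
    have hA := hsum A
    -- Since `A v = 0`, each coefficient of `v` along an eigenvector with nonzero eigenvalue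
    -- vanishes.
    have hz : ∀ i, u.repr (WithLp.toLp 2 v) i * (t i : ℂ) = 0 := by
      have h0 : ∑ i, (u.repr (WithLp.toLp 2 v) i * (t i : ℂ)) • u i = 0 := by
        rw [hv] at hA
        have : WithLp.toLp 2 (0 : Fin d → ℂ) = 0 := rfl
        rw [← this, hA]
        refine Finset.sum_congr rfl fun i _ => ?_
        rw [hu i, mul_smul]; rfl
      intro i
      exact Fintype.linearIndependent_iff.1 u.orthonormal.linearIndependent _ h0 i
    have hρ0 := hsum ρ
    rw [Finset.sum_eq_zero] at hρ0
    · exact congrArg WithLp.ofLp hρ0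
    · intro i _
      rcases mul_eq_zero.1 (hz i) with h1 | h1
      · rw [h1, zero_smul]
      · rw [(weight_eq_zero_iff hρ u i).1 (h i (Complex.ofReal_eq_zero.1 h1))]
        simp

theorem traceLog_eq_sum_weight {ρ A : Matrix (Fin d) (Fin d) ℂ} (hA : A.IsHermitian)
    (hker : ∀ v : Fin d → ℂ, A *ᵥ v = 0 → ρ *ᵥ v = 0) :
    traceLog ρ A = ((∑ i, weight ρ hA.eigenvectorBasis i * Real.log (hA.eigenvalues i) : ℝ) :
      EReal) :=
  traceLog_eq ρ A hA _ _ (fun i => by simpa using hA.mulVec_eigenvectorBasis i) hker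

/-- Jensen's inequality in tangent-line form: `log (t / N) ≤ t / N - 1`, averaged with the weights
of `ρ`, which sum to `1`. -/
theorem traceLog_le_log {ρ A : Matrix (Fin d) (Fin d) ℂ} (hρ : ρ ∈ states d)
    (hA : A.PosSemidef) {N : ℝ} (hN : 0 < N) (h : (ρ * A).trace.re ≤ N) :
    traceLog ρ A ≤ (Real.log N : EReal) := by
  by_cases hker : ∀ v : Fin d → ℂ, A *ᵥ v = 0 → ρ *ᵥ v = 0
  swap
  · rw [traceLog, if_neg hker]; exact bot_le
  have hu : ∀ i, A *ᵥ (hA.1.eigenvectorBasis i).ofLp =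
      (hA.1.eigenvalues i : ℂ) • (hA.1.eigenvectorBasis i).ofLp :=
    fun i => by simpa using hA.1.mulVec_eigenvectorBasis i
  rw [traceLog_eq_sum_weight hA.1 hker, EReal.coe_le_coe_iff]
  have hw := (ker_le_iff_weight hρ.1 _ _ hu).1 hker
  have hsum := sum_weight ρ hA.1.eigenvectorBasis
  rw [hρ.2, Complex.one_re] at hsum
  rw [trace_mul_re_eq_sum_weight ρ A _ _ hu] at h
  calc ∑ i, weight ρ hA.1.eigenvectorBasis i * Real.log (hA.1.eigenvalues i)
      ≤ ∑ i, (weight ρ hA.1.eigenvectorBasis i * (Real.log N - 1) +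
          (weight ρ hA.1.eigenvectorBasis i * hA.1.eigenvalues i) / N) := by
        refine Finset.sum_le_sum fun i _ => ?_
        -- A zero eigenvalue carries zero weight by the kernel condition, so the value `Real.log 0 =
        -- 0` is harmless.
        rcases (hA.eigenvalues_nonneg i).eq_or_lt' with h0 | h0
        · simp [hw i h0]
        · have h1 := Real.log_le_sub_one_of_pos (div_pos h0 hN)
          rw [Real.log_div h0.ne' hN.ne'] at h1
          rw [mul_div_assoc, ← mul_add]
          exact mul_le_mul_of_nonneg_left (by linarith) (weight_nonneg hρ.1 _ i)
    _ = Real.log N - 1 + (∑ i, weight ρ hA.1.eigenvectorBasis i * hA.1.eigenvalues i) / N := by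
        rw [Finset.sum_add_distrib, ← Finset.sum_mul, hsum, one_mul, Finset.sum_div]
    _ ≤ Real.log N := by
        have := (div_le_one hN).2 h
        linarith

theorem traceLog_smul_one {ρ : Matrix (Fin d) (Fin d) ℂ} (hρ : ρ ∈ states d) {N : ℝ}
    (hN : 0 < N) :
    traceLog ρ (N • (1 : Matrix (Fin d) (Fin d) ℂ)) = (Real.log N : EReal) := by
  have hmul : ∀ v : Fin d → ℂ, (N • (1 : Matrix (Fin d) (Fin d) ℂ)) *ᵥ v = (N : ℂ) • v := by
    intro v
    rw [Matrix.smul_mulVec, Matrix.one_mulVec]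
    ext i; simp
  have hH : (N • (1 : Matrix (Fin d) (Fin d) ℂ)).IsHermitian := by
    rw [Matrix.IsHermitian, Matrix.conjTranspose_smul]; simp
  rw [traceLog_eq ρ _ hH (EuclideanSpace.basisFun (Fin d) ℂ) (fun _ => N) (fun i => hmul _)]
  · rw [← Finset.sum_mul]
    have := sum_weight ρ (EuclideanSpace.basisFun (Fin d) ℂ)
    rw [hρ.2, Complex.one_re] at this
    unfold weight at this
    rw [this, one_mul]
  · intro v hv
    rw [hmul, smul_eq_zero] at hv
    rcases hv with hv | hv
    · exact absurd (by exact_mod_cast hv) hN.ne'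
    · rw [hv, Matrix.mulVec_zero]

/-! ### Monotone continuous approximation of the entropy functional -/

/-- Partial sums of the power series of `-log (1 - x)`. -/
noncomputable def logSum (k : ℕ) (x : ℝ) : ℝ := ∑ n ∈ Finset.range k, x ^ (n + 1) / (n + 1)

theorem logSum_mono {x : ℝ} (hx : 0 ≤ x) : Monotone fun k => logSum k x :=
  monotone_nat_of_le_succ fun k => by
    rw [logSum, logSum, Finset.sum_range_succ]
    exact le_add_of_nonneg_right (by positivity)

theorem tendsto_logSum {x : ℝ} (hx : 0 ≤ x) (hx1 : x < 1) :
    Tendsto (fun k => logSum k x) atTop (𝓝 (-Real.log (1 - x))) :=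
  (Real.hasSum_pow_div_log_of_abs_lt_one (by rwa [abs_of_nonneg hx])).tendsto_sum_nat

theorem tendsto_logSum_one : Tendsto (fun k => logSum k 1) atTop atTop := by
  simpa [logSum] using Real.tendsto_sum_range_one_div_nat_succ_atTop

/-- Partial sums of the power series of `-log A` around `R • 1`. -/
noncomputable def logSumMatrix (R : ℝ) (k : ℕ) (A : Matrix (Fin d) (Fin d) ℂ) :
    Matrix (Fin d) (Fin d) ℂ :=
  ∑ n ∈ Finset.range k, ((n + 1 : ℝ)⁻¹) • (1 - R⁻¹ • A) ^ (n + 1)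

theorem logSumMatrix_mulVec (R : ℝ) (k : ℕ) {A : Matrix (Fin d) (Fin d) ℂ} {v : Fin d → ℂ}
    {t : ℝ} (h : A *ᵥ v = (t : ℂ) • v) :
    logSumMatrix R k A *ᵥ v = (logSum k (1 - t / R) : ℂ) • v := by
  have h1 : (1 - R⁻¹ • A) *ᵥ v = ((1 - t / R : ℝ) : ℂ) • v := by
    rw [Matrix.sub_mulVec, Matrix.smul_mulVec, h, Matrix.one_mulVec]
    ext i
    simp only [Pi.sub_apply, Pi.smul_apply, smul_eq_mul, Complex.real_smul]
    push_cast
    ring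
  have hpow : ∀ n : ℕ, ((1 - R⁻¹ • A) ^ n) *ᵥ v = (((1 - t / R : ℝ) : ℂ) ^ n) • v := by
    intro n
    induction n with
    | zero => simp
    | succ n ih =>
      rw [pow_succ, ← Matrix.mulVec_mulVec, h1, Matrix.mulVec_smul, ih, smul_smul, pow_succ,
        mul_comm]
  rw [logSumMatrix, Matrix.sum_mulVec, logSum, Complex.ofReal_sum, Finset.sum_smul]
  refine Finset.sum_congr rfl fun n _ => ?_
  rw [Matrix.smul_mulVec, hpow]
  ext i
  simp only [Pi.smul_apply, smul_eq_mul, Complex.real_smul]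
  push_cast
  ring

/-- Increasing continuous approximations of `-Tr (ρ log A)`. -/
noncomputable def entropyApprox (R : ℝ) (ρ : Matrix (Fin d) (Fin d) ℂ) (k : ℕ)
    (A : Matrix (Fin d) (Fin d) ℂ) : ℝ :=
  (ρ * logSumMatrix R k A).trace.re - Real.log R

theorem continuous_entropyApprox (R : ℝ) (ρ : Matrix (Fin d) (Fin d) ℂ) (k : ℕ) :
    Continuous (entropyApprox R ρ k) := by
  unfold entropyApprox logSumMatrix
  fun_prop

theorem eigenvalues_le_trace {A : Matrix (Fin d) (Fin d) ℂ} (hA : A.PosSemidef) (i : Fin d) :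
    hA.1.eigenvalues i ≤ A.trace.re := by
  rw [hA.1.trace_eq_sum_eigenvalues, Complex.re_sum]
  exact Finset.single_le_sum (f := fun i => ((hA.1.eigenvalues i : ℂ)).re)
    (fun j _ => hA.eigenvalues_nonneg j) (Finset.mem_univ i)

/-- For eigenvalues `0 ≤ t ≤ R`, `-log t = -log R + ∑ (1 - t / R) ^ n / n` has nonnegative series
terms, so the partial sums increase. At `t = 0` the series is harmonic, which produces `⊤` exactly
when the kernel condition fails. -/
theorem neg_traceLog_eq_iSup {ρ A : Matrix (Fin d) (Fin d) ℂ} (hρ : ρ ∈ states d)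
    (hA : A.PosSemidef) {R : ℝ} (hR : 0 < R) (hAR : A.trace.re ≤ R) :
    -traceLog ρ A = ⨆ k, (entropyApprox R ρ k A : EReal) := by
  have hu : ∀ i, A *ᵥ (hA.1.eigenvectorBasis i).ofLp =
      (hA.1.eigenvalues i : ℂ) • (hA.1.eigenvectorBasis i).ofLp :=
    fun i => by simpa using hA.1.mulVec_eigenvectorBasis i
  set w := weight ρ hA.1.eigenvectorBasis with hwdef
  set t := hA.1.eigenvalues with ht
  have hw0 : ∀ i, 0 ≤ w i := weight_nonneg hρ.1 _
  have ht0 : ∀ i, 0 ≤ t i := hA.eigenvalues_nonneg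
  have hsum : ∑ i, w i = 1 := by
    have := sum_weight ρ hA.1.eigenvectorBasis
    rwa [hρ.2, Complex.one_re] at this
  have hx0 : ∀ i, 0 ≤ 1 - t i / R := fun i => by
    have := (div_le_one hR).2 ((eigenvalues_le_trace hA i).trans hAR)
    linarith
  have happ : ∀ k, entropyApprox R ρ k A =
      ∑ i, w i * logSum k (1 - t i / R) - Real.log R := fun k => by
    rw [entropyApprox, trace_mul_re_eq_sum_weight ρ _ hA.1.eigenvectorBasis
      (fun i => logSum k (1 - t i / R)) (fun i => logSumMatrix_mulVec R k (hu i))]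
  have hmono : Monotone fun k => (entropyApprox R ρ k A : EReal) := by
    intro k l hkl
    simp only [happ, EReal.coe_le_coe_iff]
    gcongr with i
    · exact hw0 i
    · exact logSum_mono (hx0 i) hkl
  refine tendsto_nhds_unique ?_ (tendsto_atTop_iSup hmono)
  by_cases hker : ∀ v : Fin d → ℂ, A *ᵥ v = 0 → ρ *ᵥ v = 0
  · have hw := (ker_le_iff_weight hρ.1 _ _ hu).1 hker
    rw [traceLog_eq_sum_weight hA.1 hker, ← EReal.coe_neg]
    refine (continuous_coe_real_ereal.tendsto _).comp ?_
    have hlim : -∑ i, w i * Real.log (t i) =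
        ∑ i, w i * (-Real.log (t i / R)) - Real.log R := by
      have : ∀ i, w i * (-Real.log (t i / R)) = - (w i * Real.log (t i)) + w i * Real.log R := by
        intro i
        rcases (ht0 i).eq_or_lt' with h0 | h0
        · have : w i = 0 := hw i h0
          simp [this]
        · rw [Real.log_div h0.ne' hR.ne']; ring
      simp only [this]
      rw [Finset.sum_add_distrib, ← Finset.sum_mul, hsum, Finset.sum_neg_distrib]
      ring
    rw [hlim]
    simp only [happ]
    refine Tendsto.sub_const (tendsto_finsetSum _ fun i _ => ?_) _
    -- At `t i = 0` the partial sums diverge, but their weight is zero.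
    rcases (ht0 i).eq_or_lt' with h0 | h0
    · have : w i = 0 := hw i h0
      simp [this]
    · have := tendsto_logSum (hx0 i) (by have := div_pos h0 hR; linarith)
      rw [sub_sub_cancel] at this
      exact this.const_mul _
  · have hker' := hker
    rw [ker_le_iff_weight hρ.1 _ _ hu] at hker'
    push Not at hker'
    obtain ⟨i, hi, hwi⟩ := hker'
    rw [traceLog, if_neg hker, EReal.neg_bot]
    refine EReal.tendsto_coe_nhds_top_iff.2 ?_
    have hpos : 0 < w i := lt_of_le_of_ne (hw0 i) (Ne.symm hwi)
    -- One kernel eigenvector of positive weight suffices: the other terms are nonnegative and can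
    -- be dropped.
    have h1 := tendsto_atTop_add_const_right atTop (-Real.log R)
      (tendsto_logSum_one.const_mul_atTop hpos)
    refine tendsto_atTop_mono (fun k => ?_) h1
    rw [happ, sub_eq_add_neg]
    gcongr
    have h2 := Finset.single_le_sum (f := fun i => w i * logSum k (1 - t i / R))
      (fun j _ => mul_nonneg (hw0 j) (Finset.sum_nonneg fun n _ => by
        have := hx0 j
        positivity)) (Finset.mem_univ i)
    have h3 : t i = 0 := hi
    simpa [h3] using h2

/-! ### Norm bounds and compactness -/

theorem norm_entry_le_hsNorm (X : Matrix (Fin d) (Fin d) ℂ) (i j : Fin d) :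
    ‖X i j‖ ≤ hsNorm X := by
  refine Real.le_sqrt_of_sq_le ?_
  calc ‖X i j‖ ^ 2 ≤ ∑ j, ‖X i j‖ ^ 2 :=
        Finset.single_le_sum (f := fun j => ‖X i j‖ ^ 2) (fun _ _ => by positivity)
          (Finset.mem_univ j)
    _ ≤ ∑ i, ∑ j, ‖X i j‖ ^ 2 :=
        Finset.single_le_sum (f := fun i => ∑ j, ‖X i j‖ ^ 2) (fun _ _ => by positivity)
          (Finset.mem_univ i)

theorem continuous_hsNorm : Continuous (hsNorm : Matrix (Fin d) (Fin d) ℂ → ℝ) := by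
  unfold hsNorm
  fun_prop

theorem isCompact_of_isClosed_isBddSet {𝒜 : Set (Matrix (Fin d) (Fin d) ℂ)} (hc : IsClosed 𝒜)
    (hb : IsBddSet 𝒜) : IsCompact 𝒜 := by
  obtain ⟨R, hR⟩ := hb
  have hK : IsCompact (Set.univ.pi fun _ : Fin d => Set.univ.pi fun _ : Fin d =>
      Metric.closedBall (0 : ℂ) R) :=
    isCompact_univ_pi fun _ => isCompact_univ_pi fun _ => isCompact_closedBall _ _
  refine hK.of_isClosed_subset hc fun X hX i _ j _ => ?_
  rw [mem_closedBall_zero_iff]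
  exact (norm_entry_le_hsNorm X i j).trans (hR X hX)

/-- The squared norm is `Tr (B * B)`, and every eigenvalue of `B` is at most its trace. This bounds
the anti-blocker, so that `gammaParam` takes its finite branch. -/
theorem hsNorm_le_trace {B : Matrix (Fin d) (Fin d) ℂ} (hB : B.PosSemidef) :
    hsNorm B ≤ B.trace.re := by
  have h0 : 0 ≤ B.trace.re := (Complex.nonneg_iff.1 hB.trace_nonneg).1
  refine Real.sqrt_le_iff.2 ⟨h0, ?_⟩
  have h1 : ∑ i, ∑ j, ‖B i j‖ ^ 2 = (B * B).trace.re := by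
    nth_rw 3 [← hB.1.eq]
    simp only [Matrix.trace, Matrix.diag, Matrix.mul_apply, Complex.re_sum,
      Matrix.conjTranspose_apply]
    refine Finset.sum_congr rfl fun i _ => Finset.sum_congr rfl fun j _ => ?_
    rw [Complex.star_def, Complex.mul_conj, Complex.ofReal_re, Complex.normSq_eq_norm_sq]
  have hu : ∀ i, B *ᵥ (hB.1.eigenvectorBasis i).ofLp =
      (hB.1.eigenvalues i : ℂ) • (hB.1.eigenvectorBasis i).ofLp :=
    fun i => by simpa using hB.1.mulVec_eigenvectorBasis i
  rw [h1, trace_mul_re_eq_sum_weight B B _ _ hu]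
  calc _ ≤ ∑ i, weight B hB.1.eigenvectorBasis i * B.trace.re :=
        Finset.sum_le_sum fun i _ =>
          mul_le_mul_of_nonneg_left (eigenvalues_le_trace hB i) (weight_nonneg hB _ i)
    _ = B.trace.re ^ 2 := by rw [← Finset.sum_mul, sum_weight, sq]

/-! ### Separation and the supporting state -/

theorem posSemidef_of_re_nonneg {X : Matrix (Fin d) (Fin d) ℂ} (hX : X.IsHermitian)
    (h : ∀ x : Fin d → ℂ, 0 ≤ (star x ⬝ᵥ X *ᵥ x).re) : X.PosSemidef :=
  .of_dotProduct_mulVec_nonneg hX fun x =>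
    Complex.nonneg_iff.2 ⟨h x, (hX.im_star_dotProduct_mulVec_self x).symm⟩

/-- Every real functional on the complex matrices is `X ↦ Re Tr (ρ X)` for some `ρ`. -/
theorem exists_eq_trace_mul_re (g : Matrix (Fin d) (Fin d) ℂ →ₗ[ℝ] ℝ) :
    ∃ ρ : Matrix (Fin d) (Fin d) ℂ, ∀ X, g X = (ρ * X).trace.re := by
  -- The entry is chosen so that its product with `x + iy` has real part `x g(E_ij) + y g(i E_ij)`;
  -- the trace pairing transposes the indices.
  refine ⟨Matrix.of fun j i => ⟨g (Matrix.single i j 1), -g (Matrix.single i j Complex.I)⟩,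
    fun X => ?_⟩
  have h1 : ∀ i j, g (Matrix.single i j (X i j)) =
      (X i j).re * g (Matrix.single i j 1) + (X i j).im * g (Matrix.single i j Complex.I) := by
    intro i j
    rw [← smul_eq_mul, ← smul_eq_mul, ← map_smul, ← map_smul, ← map_add, Matrix.smul_single,
      Matrix.smul_single, ← Matrix.single_add]
    congr 2
    apply Complex.ext <;> simp
  conv_lhs => rw [Matrix.matrix_eq_sum_single X]
  simp only [map_sum, h1, Matrix.trace, Matrix.diag, Matrix.mul_apply, Complex.re_sum]
  rw [Finset.sum_comm]
  refine Finset.sum_congr rfl fun i _ => Finset.sum_congr rfl fun j _ => ?_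
  simp
  ring

theorem eq_zero_of_trace_mul_re_eq_zero {Y : Matrix (Fin d) (Fin d) ℂ}
    (h : ∀ X : Matrix (Fin d) (Fin d) ℂ, (Y * X).trace.re = 0) : Y = 0 := by
  rw [← Matrix.trace_mul_conjTranspose_self_eq_zero_iff]
  have h1 := Complex.nonneg_iff.1 (Matrix.posSemidef_self_mul_conjTranspose Y).trace_nonneg
  exact Complex.ext (h _) h1.2.symm

theorem trace_mul_vecMulVec (ρ : Matrix (Fin d) (Fin d) ℂ) (x : Fin d → ℂ) :
    (ρ * Matrix.vecMulVec x (star x)).trace = star x ⬝ᵥ ρ *ᵥ x := by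
  rw [Matrix.mul_vecMulVec, Matrix.trace_vecMulVec, dotProduct_comm]

/-- Matrices whose quadratic form is larger than `N` times the squared norm. -/
def formGt (d : ℕ) (N : ℝ) : Set (Matrix (Fin d) (Fin d) ℂ) :=
  {X | ∀ x : Fin d → ℂ, x ≠ 0 → 0 < (star x ⬝ᵥ (X - N • 1) *ᵥ x).re}

/-- By homogeneity only unit vectors matter; the sphere is compact and the form is jointly
continuous in the matrix and the vector. -/
theorem isOpen_formGt (N : ℝ) : IsOpen (formGt d N) := by
  have h : formGt d N = {X | ∀ x ∈ Metric.sphere (0 : Fin d → ℂ) 1,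
      0 < (star x ⬝ᵥ (X - N • 1) *ᵥ x).re} := by
    ext X
    refine ⟨fun h x hx => h x (fun h0 => by simp [h0] at hx), fun h x hx => ?_⟩
    have hn : 0 < ‖x‖ := norm_pos_iff.2 hx
    have h1 := h (((‖x‖⁻¹ : ℝ) : ℂ) • x) (by
      rw [mem_sphere_zero_iff_norm, norm_smul, Complex.norm_real, norm_inv, norm_norm,
        inv_mul_cancel₀ hn.ne'])
    rw [star_smul, smul_dotProduct, Matrix.mulVec_smul, dotProduct_smul, Complex.star_def,
      Complex.conj_ofReal, smul_eq_mul, smul_eq_mul, Complex.re_ofReal_mul,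
      Complex.re_ofReal_mul] at h1
    exact pos_of_mul_pos_right (pos_of_mul_pos_right h1 (by positivity)) (by positivity)
  rw [h, isOpen_iff_mem_nhds]
  intro X hX
  refine (isCompact_sphere (0 : Fin d → ℂ) 1).eventually_forall_of_forall_eventually
    fun x hx => ?_
  have hc : Continuous fun z : Matrix (Fin d) (Fin d) ℂ × (Fin d → ℂ) =>
      (star z.2 ⬝ᵥ (z.1 - N • 1) *ᵥ z.2).re :=
    Complex.continuous_re.comp
      (continuous_snd.star.dotProduct
        ((continuous_fst.sub continuous_const).matrix_mulVec continuous_snd))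
  exact hc.continuousAt.eventually (lt_mem_nhds (hX x hx))

theorem convex_formGt (N : ℝ) : Convex ℝ (formGt d N) := by
  intro X hX Y hY a b ha hb hab x hx
  have h : a • X + b • Y - N • 1 = a • (X - N • 1) + b • (Y - N • 1) := by
    rw [smul_sub, smul_sub, sub_add_sub_comm, ← add_smul, hab, one_smul]
  rw [h, Matrix.add_mulVec, dotProduct_add, Matrix.smul_mulVec, Matrix.smul_mulVec,
    dotProduct_smul, dotProduct_smul, Complex.add_re, Complex.smul_re, Complex.smul_re,
    smul_eq_mul, smul_eq_mul]
  have h1 := hX x hx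
  have h2 := hY x hx
  rcases ha.eq_or_lt with rfl | ha
  · rw [zero_add] at hab
    simpa [hab] using h2
  · exact add_pos_of_pos_of_nonneg (mul_pos ha h1) (mul_nonneg hb h2.le)

theorem add_mem_formGt {N : ℝ} {X Y : Matrix (Fin d) (Fin d) ℂ} (hX : X ∈ formGt d N)
    (hY : ∀ x : Fin d → ℂ, 0 ≤ (star x ⬝ᵥ Y *ᵥ x).re) : X + Y ∈ formGt d N := by
  intro x hx
  rw [add_sub_right_comm, Matrix.add_mulVec, dotProduct_add, Complex.add_re]
  exact add_pos_of_pos_of_nonneg (hX x hx) (hY x)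

theorem smul_one_mem_formGt {N β : ℝ} (h : N < β) :
    β • (1 : Matrix (Fin d) (Fin d) ℂ) ∈ formGt d N := by
  intro x hx
  rw [← sub_smul, Matrix.smul_mulVec, Matrix.one_mulVec, dotProduct_smul, Complex.smul_re,
    smul_eq_mul]
  exact mul_pos (sub_pos.2 h) (Complex.pos_iff.1 (Matrix.dotProduct_star_self_pos_iff.2 hx)).1

/-- By openness, a common element `A` would satisfy `A ≥ (N + t) • 1` for some `t > 0`, and heredity
would put `(N + t) • 1` in `𝒜`. -/
theorem disjoint_formGt {𝒜 : Set (Matrix (Fin d) (Fin d) ℂ)} (h𝒜 : IsConvexCorner 𝒜) {N : ℝ}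
    (hN : 0 ≤ N) (hmax : ∀ β, N < β → β • (1 : Matrix (Fin d) (Fin d) ℂ) ∉ 𝒜) :
    Disjoint (formGt d N) 𝒜 := by
  refine Set.disjoint_left.2 fun A hA hA' => ?_
  have hc : Continuous fun t : ℝ => A - t • (1 : Matrix (Fin d) (Fin d) ℂ) := by fun_prop
  have h0 : ∀ᶠ t in 𝓝 (0 : ℝ), A - t • (1 : Matrix (Fin d) (Fin d) ℂ) ∈ formGt d N :=
    hc.continuousAt.eventually ((isOpen_formGt N).mem_nhds (by simpa using hA))
  obtain ⟨t, ht, ht0⟩ := ((h0.filter_mono nhdsWithin_le_nhds).and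
    (self_mem_nhdsWithin : Set.Ioi (0 : ℝ) ∈ 𝓝[>] 0)).exists
  have ht0 : 0 < t := ht0
  refine hmax (N + t) (by linarith) (h𝒜.hereditary _ A hA' ?_ ?_)
  · exact Matrix.PosSemidef.one.smul (by linarith)
  · refine posSemidef_of_re_nonneg ((h𝒜.posSemidef A hA').1.sub ?_) fun x => ?_
    · exact (Matrix.PosSemidef.one.smul (by linarith : (0 : ℝ) ≤ N + t)).1
    · rcases eq_or_ne x 0 with rfl | hx
      · simp
      · have h1 := ht x hx
        rw [sub_sub, add_comm, ← add_smul] at h1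
        exact h1.le

theorem nonneg_of_forall_lt_add_mul {a b c : ℝ} (h : ∀ t : ℝ, 0 ≤ t → c < a + t * b) : 0 ≤ b := by
  by_contra! hb
  have h0 := h 0 le_rfl
  have h1 := h ((c - a) / b) (div_nonneg_of_nonpos (by linarith) hb.le)
  rw [div_mul_cancel₀ _ hb.ne] at h1
  linarith

/-- A state supporting `𝒜` at the largest multiple of the identity in `𝒜`. -/
theorem exists_state_trace_mul_le {𝒜 : Set (Matrix (Fin d) (Fin d) ℂ)} (h𝒜 : IsConvexCorner 𝒜)
    {N : ℝ} (hN : 0 ≤ N) (hmem : N • (1 : Matrix (Fin d) (Fin d) ℂ) ∈ 𝒜)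
    (hmax : ∀ β, N < β → β • (1 : Matrix (Fin d) (Fin d) ℂ) ∉ 𝒜) :
    ∃ ρ ∈ states d, ∀ A ∈ 𝒜, (ρ * A).trace.re ≤ N := by
  obtain ⟨f, u, hfU, hf𝒜⟩ := geometric_hahn_banach_open (convex_formGt N) (isOpen_formGt N)
    h𝒜.convex (disjoint_formGt h𝒜 hN hmax)
  -- Adding `t • Y`, `t ≥ 0`, stays inside `formGt d N`, where `f < u`; boundedness along this ray
  -- fixes the sign of `f Y`.
  have hpos : ∀ Y : Matrix (Fin d) (Fin d) ℂ, (∀ x : Fin d → ℂ, 0 ≤ (star x ⬝ᵥ Y *ᵥ x).re) →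
      f Y ≤ 0 := by
    intro Y hY
    have h := nonneg_of_forall_lt_add_mul (a := -f ((N + 1) • 1)) (b := -f Y) (c := -u)
      fun t ht => by
        have := hfU _ (add_mem_formGt (smul_one_mem_formGt (lt_add_one N)) (Y := t • Y) fun x => by
          rw [Matrix.smul_mulVec, dotProduct_smul, Complex.smul_re]
          exact mul_nonneg ht (hY x))
        rw [map_add, map_smul f t Y, smul_eq_mul] at this
        linarith
    linarith
  obtain ⟨σ, hσ⟩ := exists_eq_trace_mul_re (-f).toLinearMap
  replace hσ : ∀ X, (σ * X).trace.re = -f X := fun X => (hσ X).symm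
  -- The set `formGt d N` also contains non-Hermitian matrices: the form of `X - Xᴴ` has zero real
  -- part, so `hpos` applies to it and to its negative. This forces `σ` to be Hermitian.
  have hconj : ∀ X : Matrix (Fin d) (Fin d) ℂ, f Xᴴ = f X := by
    intro X
    have hq : ∀ x : Fin d → ℂ, (star x ⬝ᵥ Xᴴ *ᵥ x).re = (star x ⬝ᵥ X *ᵥ x).re := by
      intro x
      have : star x ⬝ᵥ Xᴴ *ᵥ x = star (star x ⬝ᵥ X *ᵥ x) := by
        rw [← Matrix.star_dotProduct_star, Matrix.star_mulVec, star_star,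
          Matrix.dotProduct_mulVec, dotProduct_comm]
      rw [this, Complex.star_def, Complex.conj_re]
    have h1 := hpos (Xᴴ - X) fun x => by
      rw [Matrix.sub_mulVec, dotProduct_sub, Complex.sub_re, hq, sub_self]
    have h2 := hpos (X - Xᴴ) fun x => by
      rw [Matrix.sub_mulVec, dotProduct_sub, Complex.sub_re, hq, sub_self]
    rw [map_sub] at h1 h2
    linarith
  have hherm : σ.IsHermitian := by
    refine (sub_eq_zero.1 (eq_zero_of_trace_mul_re_eq_zero fun X => ?_))
    have h1 : (σᴴ * X).trace = star ((σ * Xᴴ).trace) := by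
      rw [← Matrix.trace_conjTranspose, Matrix.conjTranspose_mul, Matrix.conjTranspose_conjTranspose,
        Matrix.trace_mul_comm]
    rw [sub_mul, Matrix.trace_sub, Complex.sub_re, h1, Complex.star_def, Complex.conj_re, hσ, hσ,
      hconj, sub_self]
  have hσp : σ.PosSemidef := posSemidef_of_re_nonneg hherm fun x => by
    rw [← trace_mul_vecMulVec, hσ]
    have := hpos _ fun y =>
      (Matrix.posSemidef_vecMulVec_self_star x).re_dotProduct_nonneg y
    linarith
  have hone : ∀ β : ℝ, f (β • 1) = -(β * σ.trace.re) := fun β => by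
    have := hσ 1
    rw [mul_one] at this
    rw [map_smul, smul_eq_mul, this]
    ring
  have hlt : ∀ β, N < β → -u < β * σ.trace.re := fun β hβ => by
    have := hfU _ (smul_one_mem_formGt hβ)
    rw [hone] at this
    linarith
  -- Separation gives `N * Tr σ ≤ -u < (N + 1) * Tr σ`, hence a positive trace to normalise by.
  have hT : 0 < σ.trace.re := by
    have h1 := hlt (N + 1) (lt_add_one N)
    have h2 := hf𝒜 _ hmem
    rw [hone] at h2
    linarith
  have hle : ∀ A ∈ 𝒜, (σ * A).trace.re ≤ N * σ.trace.re := by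
    intro A hA
    rw [hσ]
    have h1 := hf𝒜 A hA
    refine le_of_forall_pos_le_add fun ε hε => ?_
    have h2 := hlt (N + ε / σ.trace.re) (by have := div_pos hε hT; linarith)
    rw [add_mul, div_mul_cancel₀ _ hT.ne'] at h2
    linarith
  refine ⟨(σ.trace.re)⁻¹ • σ, ⟨hσp.smul (inv_nonneg.2 hT.le), ?_⟩, fun A hA => ?_⟩
  · rw [Matrix.trace_smul]
    have him := (Complex.nonneg_iff.1 hσp.trace_nonneg).2
    apply Complex.ext
    · rw [Complex.smul_re, smul_eq_mul, inv_mul_cancel₀ hT.ne', Complex.one_re]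
    · rw [Complex.smul_im, ← him, smul_zero, Complex.one_im]
  · rw [smul_mul_assoc, Matrix.trace_smul, Complex.smul_re, smul_eq_mul, inv_mul_le_iff₀ hT,
      mul_comm]
    exact hle A hA

/-! ### Attainment of the entropy and of the largest scalar -/

theorem IsStandard.isCompact {𝒜 : Set (Matrix (Fin d) (Fin d) ℂ)} (h𝒜 : IsStandard 𝒜) :
    IsCompact 𝒜 :=
  isCompact_of_isClosed_isBddSet h𝒜.isClosed h𝒜.bounded

/-- The minimum defining the entropy is attained. -/
theorem isLeast_entropy {𝒜 : Set (Matrix (Fin d) (Fin d) ℂ)} (h𝒜 : IsStandard 𝒜)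
    {ρ : Matrix (Fin d) (Fin d) ℂ} (hρ : ρ ∈ states d) :
    IsLeast (entropyValues 𝒜 ρ) (entropy 𝒜 ρ) := by
  have hc : Continuous fun A : Matrix (Fin d) (Fin d) ℂ => A.trace.re := by fun_prop
  obtain ⟨A₀, hA₀, hmax⟩ := h𝒜.isCompact.exists_isMaxOn h𝒜.nonempty hc.continuousOn
  have hR0 : 0 ≤ A₀.trace.re := (Complex.nonneg_iff.1 (h𝒜.posSemidef A₀ hA₀).trace_nonneg).1
  -- The scale is the maximal trace plus `1`, so that it is positive and bounds all traces on `𝒜`.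
  have hlsc : LowerSemicontinuousOn
      (fun A => ⨆ k, (entropyApprox (A₀.trace.re + 1) ρ k A : EReal)) 𝒜 :=
    lowerSemicontinuousOn_iSup fun k =>
      (continuous_coe_real_ereal.comp
        (continuous_entropyApprox _ ρ k)).lowerSemicontinuous.lowerSemicontinuousOn _
  have heq : ∀ A ∈ 𝒜, -traceLog ρ A = ⨆ k, (entropyApprox (A₀.trace.re + 1) ρ k A : EReal) :=
    fun A hA => by
      have : A.trace.re ≤ A₀.trace.re := hmax hA
      exact neg_traceLog_eq_iSup hρ (h𝒜.posSemidef A hA) (by linarith) (by linarith)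
  obtain ⟨A, hA, hmin⟩ := hlsc.exists_isMinOn h𝒜.nonempty h𝒜.isCompact
  have hleast : IsLeast (entropyValues 𝒜 ρ) (-traceLog ρ A) := by
    refine ⟨⟨A, hA, rfl⟩, ?_⟩
    rintro _ ⟨B, hB, rfl⟩
    rw [heq A hA, heq B hB]
    exact hmin hB
  rw [entropy, hleast.isGLB.sInf_eq]
  exact hleast

theorem IsConvexCorner.smul_one_mem {𝒜 : Set (Matrix (Fin d) (Fin d) ℂ)} (h𝒜 : IsConvexCorner 𝒜)
    {A : Matrix (Fin d) (Fin d) ℂ} (hA : A ∈ 𝒜) {β : ℝ} (hβ : 0 ≤ β)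
    (h : (A - β • 1).PosSemidef) : β • (1 : Matrix (Fin d) (Fin d) ℂ) ∈ 𝒜 :=
  h𝒜.hereditary _ A hA (Matrix.PosSemidef.one.smul hβ) h

/-- A relative interior point `A` leaves room for `A + t • 1` in `𝒜`, which dominates `t • 1`. -/
theorem exists_pos_smul_one_mem {𝒜 : Set (Matrix (Fin d) (Fin d) ℂ)} (h𝒜 : IsStandard 𝒜) :
    ∃ ε : ℝ, 0 < ε ∧ ε • (1 : Matrix (Fin d) (Fin d) ℂ) ∈ 𝒜 := by
  obtain ⟨A, hA, δ, hδ, h⟩ := h𝒜.relInterior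
  have hc : Continuous fun t : ℝ => hsNorm (t • (1 : Matrix (Fin d) (Fin d) ℂ)) :=
    continuous_hsNorm.comp (by fun_prop)
  have h0 : ∀ᶠ t in 𝓝 (0 : ℝ), hsNorm (t • (1 : Matrix (Fin d) (Fin d) ℂ)) < δ :=
    hc.continuousAt.eventually (gt_mem_nhds (by simpa [hsNorm] using hδ))
  obtain ⟨t, ht, ht0⟩ := ((h0.filter_mono nhdsWithin_le_nhds).and
    (self_mem_nhdsWithin : Set.Ioi (0 : ℝ) ∈ 𝓝[>] 0)).exists
  have ht0 : 0 < t := ht0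
  have hAp := h𝒜.posSemidef A hA
  have h1 : (t • (1 : Matrix (Fin d) (Fin d) ℂ)).PosSemidef := Matrix.PosSemidef.one.smul ht0.le
  refine ⟨t, ht0, h𝒜.smul_one_mem (h (A + t • 1) (hAp.add h1) ?_) ht0.le ?_⟩
  · rwa [add_sub_cancel_left]
  · rwa [add_sub_cancel_right]

/-- The largest multiple of the identity in a standard convex corner. -/
theorem exists_isGreatest_smul_one_mem (hd : 1 ≤ d) {𝒜 : Set (Matrix (Fin d) (Fin d) ℂ)}
    (h𝒜 : IsStandard 𝒜) :
    ∃ N : ℝ, 0 < N ∧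
      IsGreatest {β : ℝ | 0 ≤ β ∧ β • (1 : Matrix (Fin d) (Fin d) ℂ) ∈ 𝒜} N := by
  obtain ⟨ε, hε, hεmem⟩ := exists_pos_smul_one_mem h𝒜
  obtain ⟨R, hR⟩ := h𝒜.bounded
  have hc : Continuous fun t : ℝ => t • (1 : Matrix (Fin d) (Fin d) ℂ) := by fun_prop
  have hK : IsCompact {β : ℝ | 0 ≤ β ∧ β • (1 : Matrix (Fin d) (Fin d) ℂ) ∈ 𝒜} := by
    refine (isCompact_Icc (a := (0 : ℝ)) (b := R)).of_isClosed_subset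
      (isClosed_Ici.inter (h𝒜.isClosed.preimage hc)) fun β hβ => ⟨hβ.1, ?_⟩
    have h := (norm_entry_le_hsNorm _ ⟨0, hd⟩ ⟨0, hd⟩).trans (hR _ hβ.2)
    rw [Matrix.smul_apply, Matrix.one_apply_eq, norm_smul, norm_one, mul_one] at h
    exact (le_abs_self β).trans h
  obtain ⟨N, hN⟩ := hK.exists_isGreatest ⟨ε, hε.le, hεmem⟩
  exact ⟨N, hε.trans_le (hN.2 ⟨hε.le, hεmem⟩), hN⟩

/-! ### The parameters expressed through the largest scalar -/

section Greatest

variable {𝒜 : Set (Matrix (Fin d) (Fin d) ℂ)} {N : ℝ}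

theorem isGreatest_scalarValues
    (hN : IsGreatest {β : ℝ | 0 ≤ β ∧ β • (1 : Matrix (Fin d) (Fin d) ℂ) ∈ 𝒜} N) :
    IsGreatest (scalarValues 𝒜) (ENNReal.ofReal N) := by
  refine ⟨⟨N, hN.1.1, hN.1.2, rfl⟩, ?_⟩
  rintro _ ⟨β, hβ, hmem, rfl⟩
  exact ENNReal.ofReal_le_ofReal (hN.2 ⟨hβ, hmem⟩)

theorem NParam_eq
    (hN : IsGreatest {β : ℝ | 0 ≤ β ∧ β • (1 : Matrix (Fin d) (Fin d) ℂ) ∈ 𝒜} N) :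
    NParam 𝒜 = ENNReal.ofReal N := by
  rw [NParam, if_pos, (isGreatest_scalarValues hN).isLUB.sSup_eq]
  rintro rfl
  have h0 : (0 : ℝ) ≤ N + 1 := by linarith [hN.1.1]
  have := hN.2 ⟨h0, Matrix.PosSemidef.one.smul h0⟩
  linarith

theorem IsConvexCorner.exists_support (h𝒜 : IsConvexCorner 𝒜)
    (hN : IsGreatest {β : ℝ | 0 ≤ β ∧ β • (1 : Matrix (Fin d) (Fin d) ℂ) ∈ 𝒜} N) :
    ∃ ρ ∈ states d, ∀ A ∈ 𝒜, (ρ * A).trace.re ≤ N :=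
  exists_state_trace_mul_le h𝒜 hN.1.1 hN.1.2 fun _ hβ hmem =>
    hβ.not_ge (hN.2 ⟨hN.1.1.trans hβ.le, hmem⟩)

theorem isGreatest_entropy (h𝒜 : IsConvexCorner 𝒜) (hN0 : 0 < N)
    (hN : IsGreatest {β : ℝ | 0 ≤ β ∧ β • (1 : Matrix (Fin d) (Fin d) ℂ) ∈ 𝒜} N) :
    IsGreatest (entropy 𝒜 '' states d) (-(Real.log N : EReal)) := by
  have hle : ∀ ρ ∈ states d, entropy 𝒜 ρ ≤ -(Real.log N : EReal) := fun ρ hρ =>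
    sInf_le ⟨_, hN.1.2, by rw [traceLog_smul_one hρ hN0]⟩
  obtain ⟨ρ, hρ, hsup⟩ := h𝒜.exists_support hN
  refine ⟨⟨ρ, hρ, (hle ρ hρ).antisymm (le_sInf ?_)⟩, ?_⟩
  · rintro _ ⟨A, hA, rfl⟩
    exact EReal.neg_le_neg_iff.2 (traceLog_le_log hρ (h𝒜.posSemidef A hA) hN0 (hsup A hA))
  · rintro _ ⟨σ, hσ, rfl⟩
    exact hle σ hσ

theorem trace_le_of_mem_antiBlocker (hN0 : 0 < N)
    (hmem : N • (1 : Matrix (Fin d) (Fin d) ℂ) ∈ 𝒜) {B : Matrix (Fin d) (Fin d) ℂ}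
    (hB : B ∈ antiBlocker 𝒜) : B.trace.re ≤ N⁻¹ := by
  have := hB.2 _ hmem
  rw [mul_smul_comm, mul_one, Matrix.trace_smul, Complex.smul_re, smul_eq_mul] at this
  rwa [← one_div, le_div_iff₀' hN0]

theorem isGreatest_traceValues_antiBlocker (h𝒜 : IsConvexCorner 𝒜) (hN0 : 0 < N)
    (hN : IsGreatest {β : ℝ | 0 ≤ β ∧ β • (1 : Matrix (Fin d) (Fin d) ℂ) ∈ 𝒜} N) :
    IsGreatest (traceValues (antiBlocker 𝒜)) (ENNReal.ofReal N⁻¹) := by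
  obtain ⟨ρ, hρ, hsup⟩ := h𝒜.exists_support hN
  refine ⟨⟨N⁻¹ • ρ, ⟨hρ.1.smul (inv_nonneg.2 hN0.le), fun A hA => ?_⟩, ?_⟩, ?_⟩
  · rw [smul_mul_assoc, Matrix.trace_smul, Complex.smul_re, smul_eq_mul, inv_mul_le_iff₀ hN0,
      mul_one]
    exact hsup A hA
  · rw [Matrix.trace_smul, Complex.smul_re, hρ.2, Complex.one_re, smul_eq_mul, mul_one]
  · rintro _ ⟨B, hB, rfl⟩
    exact ENNReal.ofReal_le_ofReal (trace_le_of_mem_antiBlocker hN0 hN.1.2 hB)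

theorem gammaParam_antiBlocker_eq (h𝒜 : IsConvexCorner 𝒜) (hN0 : 0 < N)
    (hN : IsGreatest {β : ℝ | 0 ≤ β ∧ β • (1 : Matrix (Fin d) (Fin d) ℂ) ∈ 𝒜} N) :
    gammaParam (antiBlocker 𝒜) = ENNReal.ofReal N⁻¹ := by
  rw [gammaParam, if_pos, (isGreatest_traceValues_antiBlocker h𝒜 hN0 hN).isLUB.sSup_eq]
  exact ⟨N⁻¹, fun B hB =>
    (hsNorm_le_trace hB.1).trans (trace_le_of_mem_antiBlocker hN0 hN.1.2 hB)⟩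

/-- The single term `N⁻¹ • (N • 1)` attains the infimum. Conversely, dividing a cover by its total
weight `s` gives a convex combination in `𝒜` dominating `s⁻¹ • 1`, so `s⁻¹ ≤ N`. -/
theorem MParam_eq (hd : 1 ≤ d) (h𝒜 : IsStandard 𝒜) (hN0 : 0 < N)
    (hN : IsGreatest {β : ℝ | 0 ≤ β ∧ β • (1 : Matrix (Fin d) (Fin d) ℂ) ∈ 𝒜} N) :
    MParam 𝒜 = ENNReal.ofReal N⁻¹ := by
  rw [MParam, if_pos h𝒜.relInterior]
  refine IsGLB.sInf_eq (IsLeast.isGLB ⟨?_, ?_⟩)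
  · refine ⟨1, fun _ => N⁻¹, fun _ => N • 1, fun _ => inv_pos.2 hN0, fun _ => hN.1.2, ?_, ?_⟩
    · rw [Fin.sum_univ_one, smul_smul, inv_mul_cancel₀ hN0.ne', one_smul, sub_self]
      exact .zero
    · rw [Fin.sum_univ_one]
  · rintro _ ⟨k, c, A, hc, hA, hpsd, rfl⟩
    refine ENNReal.ofReal_le_ofReal ?_
    have hs : 0 < ∑ i, c i := by
      -- An empty family would make `-1` positive semidefinite, impossible for `d ≥ 1`.
      rcases Nat.eq_zero_or_pos k with rfl | hk
      · have h := (Complex.nonneg_iff.1 (hpsd.diag_nonneg (i := ⟨0, hd⟩))).1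
        simp at h
        exact absurd h (by norm_num)
      · exact Finset.sum_pos (fun i _ => hc i) ⟨⟨0, hk⟩, Finset.mem_univ _⟩
    set s := ∑ i, c i with hsdef
    have hmem : ∑ i, (s⁻¹ * c i) • A i ∈ 𝒜 :=
      h𝒜.convex.sum_mem (fun i _ => mul_nonneg (inv_nonneg.2 hs.le) (hc i).le)
        (by rw [← Finset.mul_sum, ← hsdef, inv_mul_cancel₀ hs.ne']) fun i _ => hA i
    have hle := hN.2 ⟨inv_nonneg.2 hs.le, h𝒜.smul_one_mem hmem (inv_nonneg.2 hs.le) (by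
      have := hpsd.smul (inv_nonneg.2 hs.le)
      simpa only [smul_sub, Finset.smul_sum, smul_smul] using this)⟩
    exact inv_le_of_inv_le₀ hs hle

end Greatest

end ConvexCorner

theorem mainTheorem4 {d : ℕ} (hd : 1 ≤ d) (𝒜 : Set (Matrix (Fin d) (Fin d) ℂ))
    (h𝒜 : ConvexCorner.IsStandard 𝒜) :
    -- the minimum defining the entropy and the maxima defining `N` and `γ` exist,
    -- and the logarithms are well defined
    (∀ ρ ∈ ConvexCorner.states d,
      IsLeast (ConvexCorner.entropyValues 𝒜 ρ) (ConvexCorner.entropy 𝒜 ρ)) ∧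
    IsGreatest (ConvexCorner.scalarValues 𝒜) (ConvexCorner.NParam 𝒜) ∧
    IsGreatest (ConvexCorner.traceValues (ConvexCorner.antiBlocker 𝒜))
      (ConvexCorner.gammaParam (ConvexCorner.antiBlocker 𝒜)) ∧
    0 < ConvexCorner.NParam 𝒜 ∧ ConvexCorner.NParam 𝒜 < ⊤ ∧
    -- the maximal entropy
    IsGreatest (ConvexCorner.entropy 𝒜 '' ConvexCorner.states d)
      (-ENNReal.log (ConvexCorner.NParam 𝒜)) ∧
    -ENNReal.log (ConvexCorner.NParam 𝒜) = ENNReal.log (ConvexCorner.MParam 𝒜) ∧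
    ENNReal.log (ConvexCorner.MParam 𝒜) =
      ENNReal.log (ConvexCorner.gammaParam (ConvexCorner.antiBlocker 𝒜)) := by
  obtain ⟨N, hN0, hN⟩ := ConvexCorner.exists_isGreatest_smul_one_mem hd h𝒜
  have hcc := h𝒜.toIsConvexCorner
  rw [ConvexCorner.NParam_eq hN, ConvexCorner.MParam_eq hd h𝒜 hN0 hN,
    ConvexCorner.gammaParam_antiBlocker_eq hcc hN0 hN, ENNReal.log_ofReal_of_pos hN0,
    ENNReal.log_ofReal_of_pos (inv_pos.2 hN0), Real.log_inv, EReal.coe_neg]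
  exact ⟨fun ρ hρ => ConvexCorner.isLeast_entropy h𝒜 hρ, ConvexCorner.isGreatest_scalarValues hN,
    ConvexCorner.isGreatest_traceValues_antiBlocker hcc hN0 hN, ENNReal.ofReal_pos.2 hN0,
    ENNReal.ofReal_lt_top, ConvexCorner.isGreatest_entropy hcc hN0 hN, rfl, rfl⟩
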